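/- Let $T$ be a finite (unrooted) tree. A coloring of the vertices of $T$ is \emph{distinguishing} if no nontrivial automorphism of $T$ preserves all of the vertex colors. The \emph{distinguishing number} $D(T)$ is the minimum number of colors in a distinguishing coloring of $T$. The \emph{list distinguishing number} $D_\ell(T)$ is the minimum integer $k$ such that for every assignment $L=\{L(v)\}_{v\in V(T)}$ of lists of colors with $|L(v)|=k$ for all $v$, there is a distinguishing coloring $f$ of $T$ with $f(v)\in L(v)$ for all $v$. Then \[ D(T)=D_\ell(T). \] -/

import Mathlib

namespace SimpleGraph

/-- A vertex coloring `f` of `G` is distinguishing if no nontrivial automorphism of `G`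
preserves all of the vertex colors. -/
def IsDistinguishing {V : Type*} (G : SimpleGraph V) {C : Type*} (f : V → C) : Prop :=
  ∀ σ : G ≃g G, (∀ v, f (σ v) = f v) → σ = Iso.refl

/-- `G` has a distinguishing coloring with colors from a set of `k` colors. -/
def HasDistinguishingColoring {V : Type*} (G : SimpleGraph V) (k : ℕ) : Prop :=
  ∃ f : V → Fin k, G.IsDistinguishing f

/-- `G` is `L`-distinguishable: it has a distinguishing coloring `f` with `f v ∈ L v` for
every vertex `v`. -/
def IsListDistinguishable {V : Type*} (G : SimpleGraph V) (L : V → Finset ℕ) : Prop :=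
  ∃ f : V → ℕ, (∀ v, f v ∈ L v) ∧ G.IsDistinguishing f

/-- The distinguishing number `D(G)`: the least number of colors in a distinguishing coloring. -/
noncomputable def distinguishingNumber {V : Type*} (G : SimpleGraph V) : ℕ :=
  sInf {k : ℕ | G.HasDistinguishingColoring k}

/-- The list distinguishing number `D_ℓ(G)`: the least `k` such that `G` is `L`-distinguishable
for every assignment `L` of lists of size exactly `k`. -/
noncomputable def listDistinguishingNumber {V : Type*} (G : SimpleGraph V) : ℕ :=
  sInf {k : ℕ | ∀ L : V → Finset ℕ, (∀ v, (L v).card = k) → G.IsListDistinguishable L}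

theorem isDistinguishing_of_injective {V : Type*} (G : SimpleGraph V) {C : Type*} {f : V → C}
    (hf : Function.Injective f) : G.IsDistinguishing f := by
  intro σ h
  ext v
  exact hf (h v)

/-- On a finite graph the minimum defining `distinguishingNumber` is attained. -/
theorem isLeast_distinguishingNumber {V : Type*} [Finite V] (G : SimpleGraph V) :
    IsLeast {k : ℕ | G.HasDistinguishingColoring k} G.distinguishingNumber := by
  have hne : {k : ℕ | G.HasDistinguishingColoring k}.Nonempty :=
    ⟨Nat.card V, Finite.equivFin V, G.isDistinguishing_of_injective (Finite.equivFin V).injective⟩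
  exact ⟨Nat.sInf_mem hne, fun _ hk => Nat.sInf_le hk⟩

/-- On a finite graph the minimum defining `listDistinguishingNumber` is attained. -/
theorem isLeast_listDistinguishingNumber {V : Type*} [Finite V] (G : SimpleGraph V) :
    IsLeast {k : ℕ | ∀ L : V → Finset ℕ, (∀ v, (L v).card = k) → G.IsListDistinguishable L}
      G.listDistinguishingNumber := by
  have hne : {k : ℕ | ∀ L : V → Finset ℕ, (∀ v, (L v).card = k) →
      G.IsListDistinguishable L}.Nonempty := by
    refine ⟨Nat.card V, fun L hL => ?_⟩
    have := Fintype.ofFinite V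
    obtain ⟨f, hf, hmem⟩ :=
      (Finset.all_card_le_biUnion_card_iff_exists_injective L).1 (fun s => by
        rcases s.eq_empty_or_nonempty with rfl | ⟨v, hv⟩
        · simp
        · calc s.card ≤ Fintype.card V := Finset.card_le_univ s
            _ = (L v).card := by rw [hL v, Nat.card_eq_fintype_card]
            _ ≤ (s.biUnion L).card := Finset.card_le_card (Finset.subset_biUnion_of_mem L hv))
    exact ⟨f, hmem, G.isDistinguishing_of_injective hf⟩
  exact ⟨Nat.sInf_mem hne, fun _ hk => Nat.sInf_le hk⟩

end SimpleGraph

/-! Remove all pendant vertices at once and induct, for a stronger statement: vertices carry types τ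
preserved by automorphisms, `M θ` is a common list for type θ, and each `L v` is at least as long as
`M (τ v)`. A coloring is distinguishing exactly when it is injective on each cell (pendant vertices
of one type at one neighbor) and the core is distinguished by enriched data: the type records the
cell sizes, the color records the color sets of the cells (`injOn_pendantCell`,
`isDistinguishing_pruned`, `isDistinguishing_of_pruned`). A cell of size s with common list of size
n has C(n, s) possible color sets, and arbitrary lists of size at least n give no fewer
(`choose_le_card_transversalSets`). So the length hypothesis passes to the core. The recursion ends
at a vertex or an edge. -/

namespace SimpleGraph

/-! ### Counting sets of distinct representatives -/

section TransversalSets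

open scoped Classical

variable {V C : Type*}

/-- The value sets of the injective choices `g v ∈ L v`, for `v ∈ S`. -/
noncomputable def transversalSets (S : Finset V) (L : V → Finset C) : Finset (Finset C) :=
  {A ∈ (S.biUnion L).powerset | ∃ g : V → C, (∀ v ∈ S, g v ∈ L v) ∧ Set.InjOn g S ∧ S.image g = A}

theorem mem_transversalSets {S : Finset V} {L : V → Finset C} {A : Finset C} :
    A ∈ transversalSets S L ↔
      ∃ g : V → C, (∀ v ∈ S, g v ∈ L v) ∧ Set.InjOn g S ∧ S.image g = A := by
  simp only [transversalSets, Finset.mem_filter, Finset.mem_powerset, and_iff_right_iff_imp]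
  rintro ⟨g, hg, -, rfl⟩
  intro c hc
  obtain ⟨v, hv, rfl⟩ := Finset.mem_image.1 hc
  exact Finset.mem_biUnion.2 ⟨v, hv, hg v hv⟩

theorem card_of_mem_transversalSets {S : Finset V} {L : V → Finset C} {A : Finset C}
    (hA : A ∈ transversalSets S L) : A.card = S.card := by
  obtain ⟨g, -, hg, rfl⟩ := mem_transversalSets.1 hA
  exact Finset.card_image_of_injOn hg

theorem insert_mem_transversalSets {S : Finset V} {L : V → Finset C} {A : Finset C}
    (hA : A ∈ transversalSets S L) {a : V} (ha : a ∉ S) {x : C} (hx : x ∈ L a) (hxA : x ∉ A) :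
    insert x A ∈ transversalSets (insert a S) L := by
  obtain ⟨g, hg, hinj, rfl⟩ := mem_transversalSets.1 hA
  have hne : ∀ v ∈ S, Function.update g a x v = g v := fun v hv =>
    Function.update_of_ne (ne_of_mem_of_not_mem hv ha) _ _
  refine mem_transversalSets.2 ⟨Function.update g a x, ?_, ?_, ?_⟩
  · intro v hv
    rcases Finset.mem_insert.1 hv with rfl | hv
    · simpa using hx
    · rw [hne v hv]
      exact hg v hv
  · rw [Finset.coe_insert, Set.injOn_insert (by simpa using ha)]
    refine ⟨fun u hu v hv huv => hinj hu hv ?_, ?_⟩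
    · rwa [hne u hu, hne v hv] at huv
    · rintro ⟨v, hv, hvx⟩
      rw [hne v hv, Function.update_self] at hvx
      exact hxA (hvx ▸ Finset.mem_image_of_mem g hv)
  · rw [Finset.image_insert, Function.update_self, Finset.image_congr hne]

/-- Double counting gives the induction step: a set A for S extends by at least n - |S| colors of `L
a`, and each resulting set arises at most |S| + 1 times. Equality holds when all lists are one
n-set. -/
theorem choose_le_card_transversalSets [Nonempty C] (S : Finset V) (L : V → Finset C) (n : ℕ)
    (hL : ∀ v ∈ S, n ≤ (L v).card) : n.choose S.card ≤ (transversalSets S L).card := by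
  induction S using Finset.induction_on with
  | empty =>
    have hmem : ∅ ∈ transversalSets (∅ : Finset V) L := by simp [transversalSets]
    simpa using Finset.card_pos.2 ⟨_, hmem⟩
  | insert a S ha ih =>
    have ih := ih fun v hv => hL v (Finset.mem_insert_of_mem hv)
    let P : Finset (Σ _ : Finset C, C) := (transversalSets S L).sigma fun A => L a \ A
    have hP : n.choose S.card * (n - S.card) ≤ P.card := by
      rw [Finset.card_sigma]
      calc n.choose S.card * (n - S.card) ≤ (transversalSets S L).card * (n - S.card) :=
            Nat.mul_le_mul_right _ ih
        _ = ∑ _A ∈ transversalSets S L, (n - S.card) := by simp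
        _ ≤ _ := Finset.sum_le_sum fun A hA => by
            rw [← card_of_mem_transversalSets hA]
            exact (Nat.sub_le_sub_right (hL a (Finset.mem_insert_self a S)) _).trans
              (Finset.le_card_sdiff A (L a))
    have hmaps : ∀ p ∈ P, insert p.2 p.1 ∈ transversalSets (insert a S) L := by
      rintro ⟨A, x⟩ hp
      simp only [P, Finset.mem_sigma, Finset.mem_sdiff] at hp
      exact insert_mem_transversalSets hp.1 ha hp.2.1 hp.2.2
    have hfib : ∀ B ∈ transversalSets (insert a S) L,
        {p ∈ P | insert p.2 p.1 = B}.card ≤ S.card + 1 := by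
      intro B hB
      rw [← Finset.card_insert_of_notMem ha, ← card_of_mem_transversalSets hB]
      -- A pair (A, x) over B is determined by x ∈ B, since A is B with x erased.
      refine Finset.card_le_card_of_injOn (fun p => p.2) ?_ ?_
      · rintro ⟨A, x⟩ hp
        simp only [Finset.coe_filter, Set.mem_ofPred_eq] at hp
        rw [← hp.2]
        exact Finset.mem_insert_self _ _
      · rintro ⟨A, x⟩ hp ⟨A', y⟩ hq (rfl : x = y)
        simp only [Finset.coe_filter, Set.mem_ofPred_eq, P, Finset.mem_sigma,
          Finset.mem_sdiff] at hp hq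
        rw [← Finset.erase_insert hp.1.2.2, ← Finset.erase_insert hq.1.2.2, hp.2, hq.2]
    have hcard := Finset.card_le_mul_card_image_of_maps_to hmaps (S.card + 1) hfib
    rw [Finset.card_insert_of_notMem ha]
    refine Nat.le_of_mul_le_mul_left ?_ (Nat.succ_pos S.card)
    calc (S.card + 1) * n.choose (S.card + 1) = n.choose S.card * (n - S.card) := by
          rw [mul_comm, Nat.choose_succ_right_eq]
      _ ≤ _ := hP.trans hcard

end TransversalSets

/-! ### Pendant vertices and the core -/

section Pruning

open scoped Classical

variable {V : Type*} {G : SimpleGraph V}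

/-- A pendant vertex is a vertex with exactly one neighbor. -/
def IsPendant (G : SimpleGraph V) (v : V) : Prop :=
  ∃ p, ∀ x, G.Adj v x ↔ x = p

/-- The set of the vertices that are not pendant. -/
def core (G : SimpleGraph V) : Set V :=
  {v | ¬ G.IsPendant v}

theorem IsPendant.map_iso {v : V} (hv : G.IsPendant v) (σ : G ≃g G) : G.IsPendant (σ v) := by
  obtain ⟨p, hp⟩ := hv
  refine ⟨σ p, fun x => ?_⟩
  obtain ⟨x, rfl⟩ := σ.surjective x
  rw [σ.map_adj_iff, hp, σ.injective.eq_iff]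

theorem isPendant_iso_iff {v : V} (σ : G ≃g G) : G.IsPendant (σ v) ↔ G.IsPendant v :=
  ⟨fun h => by simpa using h.map_iso σ.symm, fun h => h.map_iso σ⟩

theorem mem_core_iso_iff {v : V} (σ : G ≃g G) : σ v ∈ G.core ↔ v ∈ G.core :=
  not_congr (isPendant_iso_iff σ)

/-- A map sending every pendant vertex to its neighbor, and fixing all other vertices. -/
structure IsPruning (G : SimpleGraph V) (r : V → G.core) : Prop where
  apply_core : ∀ w : G.core, r w = w
  adj_iff : ∀ v ∉ G.core, ∀ x, G.Adj v x ↔ x = r v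

variable {r : V → G.core}

theorem IsPruning.apply_iso (hr : G.IsPruning r) (σ : G ≃g G) {v : V} (hv : v ∉ G.core) :
    (r (σ v) : V) = σ (r v) := by
  have h : G.Adj (σ v) (σ (r v)) := σ.map_adj_iff.2 ((hr.adj_iff v hv _).2 rfl)
  exact ((hr.adj_iff _ ((mem_core_iso_iff σ).not.2 hv) _).1 h).symm

/-- The map `r` sends each edge to an edge or to a single vertex, so walks project to the core. -/
theorem IsPruning.connected_induce_core (hr : G.IsPruning r) (hG : G.Connected) :
    (G.induce G.core).Connected := by
  have hstep : ∀ u v, G.Adj u v → (G.induce G.core).Reachable (r u) (r v) := by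
    intro u v huv
    by_cases hu : u ∈ G.core
    · by_cases hv : v ∈ G.core
      · rw [show r u = ⟨u, hu⟩ from hr.apply_core ⟨u, hu⟩,
          show r v = ⟨v, hv⟩ from hr.apply_core ⟨v, hv⟩]
        exact Adj.reachable (by simpa using huv)
      · obtain rfl := (hr.adj_iff v hv u).1 huv.symm
        rw [hr.apply_core]
    · obtain rfl := (hr.adj_iff u hu v).1 huv
      rw [hr.apply_core]
  have hwalk : ∀ u v, G.Walk u v → (G.induce G.core).Reachable (r u) (r v) := by
    intro u v p
    induction p with
    | nil => rfl
    | cons h _ ih => exact (hstep _ _ h).trans ih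
  have := hG.nonempty
  have : Nonempty G.core := ⟨r (Classical.arbitrary V)⟩
  refine Connected.mk fun u v => ?_
  obtain ⟨p⟩ := hG.preconnected u v
  simpa only [hr.apply_core] using hwalk _ _ p

/-! ### Transfer of types, colorings and lists to the core -/

variable [Fintype V] {Θ C : Type}

/-- The pendant vertices of type `θ` attached to `w`. -/
noncomputable def pendantCell (r : V → G.core) (τ : V → Θ) (w : G.core) (θ : Θ) : Finset V :=
  {v | v ∉ G.core ∧ r v = w ∧ τ v = θ}

theorem mem_pendantCell {τ : V → Θ} {w : G.core} {θ : Θ} {v : V} :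
    v ∈ pendantCell r τ w θ ↔ v ∉ G.core ∧ r v = w ∧ τ v = θ := by
  simp [pendantCell]

/-- The type of a core vertex `w` of the pruned graph: its own type and the numbers of pendant
vertices of each type attached to it. -/
noncomputable def prunedType (r : V → G.core) (τ : V → Θ) (w : G.core) :
    Θ × (Θ → Fin (Fintype.card V + 1)) :=
  -- Bounding the counts by |V| keeps the type space finite, as the next pruning requires.
  (τ w, fun θ => ⟨(pendantCell r τ w θ).card, Nat.lt_succ_of_le (Finset.card_le_univ _)⟩)

/-- The color of a core vertex `w` of the pruned graph: its own color and the sets of colors on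
the pendant vertices of each type attached to it. -/
noncomputable def prunedColoring (r : V → G.core) (τ : V → Θ) (g : V → C) (w : G.core) :
    C × (Θ → Finset C) :=
  (g w, fun θ => (pendantCell r τ w θ).image g)

/-- Swapping two equally colored vertices of a cell would be a nontrivial automorphism preserving
types and colors. -/
theorem IsPruning.injOn_pendantCell (hr : G.IsPruning r) {τ : V → Θ} {g : V → C}
    (hg : G.IsDistinguishing fun v => (τ v, g v)) (w : G.core) (θ : Θ) :
    Set.InjOn g (pendantCell r τ w θ) := by
  intro a ha b hb hab
  simp only [Finset.mem_coe, mem_pendantCell] at ha hb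
  have hA : ∀ x, G.Adj a x ↔ x = w := fun x => by rw [hr.adj_iff a ha.1, ha.2.1]
  have hB : ∀ x, G.Adj b x ↔ x = w := fun x => by rw [hr.adj_iff b hb.1, hb.2.1]
  have hwa : (w : V) ≠ a := fun h => ha.1 (h ▸ w.2)
  have hwb : (w : V) ≠ b := fun h => hb.1 (h ▸ w.2)
  have hswap : Equiv.swap a b (w : V) = w := Equiv.swap_apply_of_ne_of_ne hwa hwb
  have hmoved : ∀ u v, u = a ∨ u = b →
      (G.Adj (Equiv.swap a b u) (Equiv.swap a b v) ↔ G.Adj u v) := by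
    intro u v hu
    have h1 : ∀ x, G.Adj (Equiv.swap a b u) x ↔ x = w := by
      rcases hu with rfl | rfl <;> simpa
    have h2 : ∀ x, G.Adj u x ↔ x = w := by
      rcases hu with rfl | rfl <;> assumption
    rw [h1, h2, ← (Equiv.swap a b).injective.eq_iff (a := v), hswap]
  let σ : G ≃g G :=
    { Equiv.swap a b with
      map_rel_iff' := by
        intro u v
        change G.Adj (Equiv.swap a b u) (Equiv.swap a b v) ↔ G.Adj u v
        by_cases hu : u = a ∨ u = b
        · exact hmoved u v hu
        by_cases hv : v = a ∨ v = b
        · rw [G.adj_comm, hmoved v u hv, G.adj_comm]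
        push Not at hu hv
        rw [Equiv.swap_apply_of_ne_of_ne hu.1 hu.2, Equiv.swap_apply_of_ne_of_ne hv.1 hv.2] }
  have hσ : ∀ v, σ v = Equiv.swap a b v := fun _ => rfl
  have hid := hg σ fun v => by
    rw [hσ]
    by_cases hva : v = a
    · subst hva
      simp [hab, ha.2.2, hb.2.2]
    by_cases hvb : v = b
    · subst hvb
      simp [hab, ha.2.2, hb.2.2]
    rw [Equiv.swap_apply_of_ne_of_ne hva hvb]
  have := hσ a
  rw [hid, Equiv.swap_apply_left] at this
  exact this

/-- An automorphism restricts to the core and permutes cells, so it fixes the core pointwise; each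
pendant vertex then stays in its cell, where colors are distinct. -/
theorem IsPruning.isDistinguishing_of_pruned (hr : G.IsPruning r) {τ : V → Θ} {g : V → C}
    (hinj : ∀ w θ, Set.InjOn g (pendantCell r τ w θ))
    (hg : (G.induce G.core).IsDistinguishing
      fun w => (prunedType r τ w, prunedColoring r τ g w)) :
    G.IsDistinguishing fun v => (τ v, g v) := by
  intro σ hσ
  have hτ : ∀ v, τ (σ v) = τ v := fun v => congrArg Prod.fst (hσ v)
  have hgσ : ∀ v, g (σ v) = g v := fun v => congrArg Prod.snd (hσ v)
  let e : G.core ≃ G.core := σ.toEquiv.subtypeEquiv fun v => (mem_core_iso_iff σ).symm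
  let σ' : G.induce G.core ≃g G.induce G.core :=
    { e with map_rel_iff' := fun {u v} => σ.map_adj_iff (v := (u : V)) (w := v) }
  have hσ' : ∀ w, ((σ' w : G.core) : V) = σ w := fun _ => rfl
  have hcell : ∀ w θ, pendantCell r τ (σ' w) θ = (pendantCell r τ w θ).image σ := by
    intro w θ
    ext v
    obtain ⟨v, rfl⟩ := σ.surjective v
    rw [σ.injective.mem_finset_image, mem_pendantCell, mem_pendantCell, mem_core_iso_iff, hτ]
    refine and_congr_right fun hv => and_congr_left fun _ => ?_
    rw [Subtype.ext_iff, hr.apply_iso σ hv, hσ', σ.injective.eq_iff, Subtype.ext_iff]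
  have hid := hg σ' fun w => by
    refine Prod.ext (Prod.ext (hτ w) (funext fun θ => Fin.ext ?_))
      (Prod.ext (hgσ w) (funext fun θ => ?_))
    · simp only [prunedType, hcell]
      exact Finset.card_image_of_injective _ σ.injective
    · simp only [prunedColoring, hcell, Finset.image_image]
      exact Finset.image_congr fun v _ => hgσ v
  have hcore : ∀ w : G.core, σ w = w := fun w => by rw [← hσ', hid]; rfl
  ext v
  change σ v = v
  by_cases hv : v ∈ G.core
  · exact hcore ⟨v, hv⟩
  · refine hinj (r v) (τ v) ?_ ?_ (hgσ v)
    · rw [Finset.mem_coe, mem_pendantCell, mem_core_iso_iff, Subtype.ext_iff, hr.apply_iso σ hv,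
        hcore]
      exact ⟨hv, rfl, hτ v⟩
    · exact Finset.mem_coe.2 (mem_pendantCell.2 ⟨hv, rfl, rfl⟩)

theorem IsPruning.isDistinguishing_pruned (hr : G.IsPruning r) {τ : V → Θ} {g : V → C}
    (hg : G.IsDistinguishing fun v => (τ v, g v)) :
    (G.induce G.core).IsDistinguishing
      fun w => (prunedType r τ w, prunedColoring r τ g w) := by
  intro σ hσ
  have hτ : ∀ w, τ (σ w) = τ w := fun w => congrArg (fun p => p.1.1) (hσ w)
  have hgσ : ∀ w, g (σ w) = g w := fun w => congrArg (fun p => p.2.1) (hσ w)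
  have himage : ∀ w θ,
      (pendantCell r τ (σ w) θ).image g = (pendantCell r τ w θ).image g := fun w θ =>
    congrFun (congrArg (fun p => p.2.2) (hσ w)) θ
  -- Extend σ to all of `G`: a pendant vertex v goes to a vertex of the same type and color attached
  -- to σ (r v), available because the color sets of corresponding cells agree.
  have hext : ∀ v, ∃ v' : V, (∀ h : v ∈ G.core, v' = σ ⟨v, h⟩) ∧
      (v ∉ G.core → v' ∉ G.core ∧ r v' = σ (r v)) ∧ τ v' = τ v ∧ g v' = g v := by
    intro v
    by_cases hv : v ∈ G.core
    · exact ⟨σ ⟨v, hv⟩, fun _ => rfl, fun h => absurd hv h, hτ ⟨v, hv⟩, hgσ ⟨v, hv⟩⟩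
    · have hmem : g v ∈ (pendantCell r τ (σ (r v)) (τ v)).image g := by
        rw [himage]
        exact Finset.mem_image_of_mem g (mem_pendantCell.2 ⟨hv, rfl, rfl⟩)
      obtain ⟨v', hv', hgv'⟩ := Finset.mem_image.1 hmem
      rw [mem_pendantCell] at hv'
      exact ⟨v', fun h => absurd h hv, fun _ => ⟨hv'.1, hv'.2.1⟩, hv'.2.2, hgv'⟩
  choose F hFcore hFpend hFτ hFg using hext
  have hF : ∀ w : G.core, F w = σ w := fun w => hFcore w w.2
  have hFmem : ∀ v, F v ∈ G.core ↔ v ∈ G.core := fun v =>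
    ⟨fun h => by_contra fun hv => (hFpend v hv).1 h, fun h => by rw [hFcore v h]; exact (σ _).2⟩
  have hFinj : Function.Injective F := by
    intro a b hab
    by_cases ha : a ∈ G.core
    · have hb : b ∈ G.core := (hFmem b).1 (hab ▸ (hFmem a).2 ha)
      rw [hFcore a ha, hFcore b hb, ← Subtype.ext_iff, σ.injective.eq_iff] at hab
      exact congrArg Subtype.val hab
    · have hb : b ∉ G.core := fun hb => ha ((hFmem a).1 (hab ▸ (hFmem b).2 hb))
      have hrab : r a = r b := σ.injective (by rw [← (hFpend a ha).2, hab, (hFpend b hb).2])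
      refine hr.injOn_pendantCell hg (r b) (τ b) ?_ ?_ (by rw [← hFg a, hab, hFg])
      · exact Finset.mem_coe.2 (mem_pendantCell.2 ⟨ha, hrab, by rw [← hFτ a, hab, hFτ]⟩)
      · exact Finset.mem_coe.2 (mem_pendantCell.2 ⟨hb, rfl, rfl⟩)
  have hFpendAdj : ∀ u v, u ∉ G.core → (G.Adj (F u) (F v) ↔ G.Adj u v) := by
    intro u v hu
    rw [hr.adj_iff _ (hFpend u hu).1, (hFpend u hu).2, hr.adj_iff u hu, ← hF, hFinj.eq_iff]
  let Φ : G ≃g G :=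
    { Equiv.ofBijective F (Finite.injective_iff_bijective.1 hFinj) with
      map_rel_iff' := by
        intro u v
        change G.Adj (F u) (F v) ↔ G.Adj u v
        by_cases hu : u ∈ G.core
        · by_cases hv : v ∈ G.core
          · rw [hFcore u hu, hFcore v hv]
            exact σ.map_adj_iff (v := ⟨u, hu⟩) (w := ⟨v, hv⟩)
          · rw [G.adj_comm, hFpendAdj v u hv, G.adj_comm]
        · exact hFpendAdj u v hu }
  have hid := hg Φ fun v => Prod.ext (hFτ v) (hFg v)
  ext w
  change (σ w : V) = w
  rw [← hF, show F w = Φ w from rfl, hid]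
  rfl

/-- The colors available in the pruned graph to a vertex with list `A`, whose pendant neighbors of
type `θ` form the set `S θ` and have the lists `L`. -/
noncomputable def prunedList [Fintype Θ] (A : Finset C) (S : Θ → Finset V) (L : V → Finset C) :
    Finset (C × (Θ → Finset C)) :=
  A ×ˢ Fintype.piFinset fun θ => transversalSets (S θ) L

/-- The colors available in the pruned graph to a vertex of a given type, when every vertex of type
`θ` has the list `M θ` in the original graph. -/
noncomputable def prunedTypeList [Fintype Θ] {N : ℕ} (M : Θ → Finset C) (t : Θ × (Θ → Fin N)) :
    Finset (C × (Θ → Finset C)) :=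
  M t.1 ×ˢ Fintype.piFinset fun θ => (M θ).powersetCard (t.2 θ)

theorem card_prunedTypeList_le [Fintype Θ] [Nonempty C] {τ : V → Θ} {M : Θ → Finset C} {L : V → Finset C}
    (hML : ∀ v, (M (τ v)).card ≤ (L v).card) (w : G.core) :
    (prunedTypeList M (prunedType r τ w)).card ≤
      (prunedList (L w) (pendantCell r τ w) L).card := by
  simp only [prunedTypeList, prunedList, Finset.card_product, Fintype.card_piFinset,
    Finset.card_powersetCard, prunedType]
  refine Nat.mul_le_mul (hML w) (Finset.prod_le_prod' fun θ _ => ?_)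
  refine choose_le_card_transversalSets _ _ _ fun v hv => ?_
  rw [← (mem_pendantCell.1 hv).2.2]
  exact hML v

theorem prunedColoring_mem_prunedTypeList [Fintype Θ] {τ : V → Θ} {M : Θ → Finset C} {f : V → C}
    (hf : ∀ v, f v ∈ M (τ v)) (hinj : ∀ w θ, Set.InjOn f (pendantCell r τ w θ)) (w : G.core) :
    prunedColoring r τ f w ∈ prunedTypeList M (prunedType r τ w) := by
  refine Finset.mem_product.2 ⟨hf w, Fintype.mem_piFinset.2 fun θ => ?_⟩
  refine Finset.mem_powersetCard.2 ⟨?_, Finset.card_image_of_injOn (hinj w θ)⟩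
  intro c hc
  obtain ⟨v, hv, rfl⟩ := Finset.mem_image.1 hc
  rw [← (mem_pendantCell.1 hv).2.2]
  exact hf v

/-- Each pendant vertex lies in exactly one cell, so the injective choices realizing the color sets
glue together. -/
theorem IsPruning.exists_coloring_of_prunedList [Fintype Θ] (hr : G.IsPruning r) {τ : V → Θ}
    {L : V → Finset C} {g' : G.core → C × (Θ → Finset C)}
    (hg' : ∀ w : G.core, g' w ∈ prunedList (L w) (pendantCell r τ w) L) :
    ∃ g : V → C, (∀ v, g v ∈ L v) ∧ (∀ w θ, Set.InjOn g (pendantCell r τ w θ)) ∧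
      prunedColoring r τ g = g' := by
  have h1 : ∀ w : G.core, (g' w).1 ∈ L w := fun w => (Finset.mem_product.1 (hg' w)).1
  have h2 : ∀ w θ, (g' w).2 θ ∈ transversalSets (pendantCell r τ w θ) L := fun w θ =>
    Fintype.mem_piFinset.1 (Finset.mem_product.1 (hg' w)).2 θ
  simp only [mem_transversalSets] at h2
  choose h hmem hinj himg using h2
  let g : V → C := fun v => if v ∈ G.core then (g' (r v)).1 else h (r v) (τ v) v
  have hgcore : ∀ w : G.core, g w = (g' w).1 := fun w => by
    simp only [g, if_pos w.2, hr.apply_core]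
  have hgcell : ∀ w θ, Set.EqOn g (h w θ) (pendantCell r τ w θ) := by
    intro w θ v hv
    obtain ⟨hcore, rfl, rfl⟩ := mem_pendantCell.1 (Finset.mem_coe.1 hv)
    simp only [g, if_neg hcore]
  refine ⟨g, fun v => ?_, fun w θ => (hgcell w θ).injOn_iff.2 (hinj w θ), ?_⟩
  · by_cases hv : v ∈ G.core
    · rw [hgcore ⟨v, hv⟩]
      exact h1 ⟨v, hv⟩
    · have hcell : v ∈ pendantCell r τ (r v) (τ v) := mem_pendantCell.2 ⟨hv, rfl, rfl⟩
      rw [hgcell _ _ (Finset.mem_coe.2 hcell)]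
      exact hmem _ _ v hcell
  · funext w
    refine Prod.ext (hgcore w) (funext fun θ => ?_)
    rw [← himg w θ]
    exact Finset.image_congr (hgcell w θ)

end Pruning

/-! ### The induction on trees -/

section Trees

variable {V : Type*} {T : SimpleGraph V}

theorem IsTree.exists_isPendant [Finite V] [Nontrivial V] (hT : T.IsTree) :
    ∃ v, T.IsPendant v := by
  classical
  have := Fintype.ofFinite V
  obtain ⟨v, hv⟩ := hT.exists_vert_degree_one_of_nontrivial
  obtain ⟨p, hp⟩ := Finset.card_eq_one.1 hv
  exact ⟨v, p, fun x => by rw [← mem_neighborFinset, hp, Finset.mem_singleton]⟩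

theorem Connected.eq_or_eq_of_adj_iff (hT : T.Connected) {a b : V} (ha : ∀ x, T.Adj a x ↔ x = b)
    (hb : ∀ x, T.Adj b x ↔ x = a) (v : V) : v = a ∨ v = b := by
  have hwalk : ∀ u v, T.Walk u v → (u = a ∨ u = b) → (v = a ∨ v = b) := by
    intro u v p
    induction p with
    | nil => exact id
    | cons h _ ih =>
      rintro (rfl | rfl)
      · exact ih (Or.inr ((ha _).1 h))
      · exact ih (Or.inl ((hb _).1 h))
  obtain ⟨p⟩ := hT.preconnected a v
  exact hwalk _ _ p (Or.inl rfl)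

theorem exists_isDistinguishing_of_pair {Θ C : Type*} {a b : V} (hab : a ≠ b)
    (hV : ∀ v, v = a ∨ v = b) (ha : ∀ x, T.Adj a x ↔ x = b) (hb : ∀ x, T.Adj b x ↔ x = a)
    {τ : V → Θ} {M : Θ → Finset C} {L : V → Finset C}
    (hML : ∀ v, (M (τ v)).card ≤ (L v).card) {f : V → C} (hfM : ∀ v, f v ∈ M (τ v))
    (hf : T.IsDistinguishing fun v => (τ v, f v)) :
    ∃ g : V → C, (∀ v, g v ∈ L v) ∧ T.IsDistinguishing fun v => (τ v, g v) := by
  classical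
  have hne : ∀ v, (L v).Nonempty := fun v =>
    Finset.card_pos.1 ((Finset.card_pos.2 ⟨_, hfM v⟩).trans_le (hML v))
  obtain ⟨x, hx⟩ := hne a
  obtain ⟨y, hy, hxy⟩ : ∃ y ∈ L b, τ a = τ b → x ≠ y := by
    by_cases hτ : τ a = τ b
    · have hfab : f a ≠ f b := by
        intro hfab
        let σ : T ≃g T :=
          { Equiv.swap a b with
            map_rel_iff' := by
              intro u v
              change T.Adj (Equiv.swap a b u) (Equiv.swap a b v) ↔ T.Adj u v
              rcases hV u with rfl | rfl <;> rcases hV v with rfl | rfl <;>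
                simp [ha, hb] }
        have hid := hf σ fun v => by
          change (τ (Equiv.swap a b v), f (Equiv.swap a b v)) = _
          rcases hV v with rfl | rfl <;> simp [hτ, hfab]
        have hσ : σ a = b := Equiv.swap_apply_left a b
        rw [hid] at hσ
        exact hab hσ
      -- With equal types, f uses two colors of one common list, so `L b` can avoid x.
      have hcard : 1 < (L b).card := by
        refine lt_of_lt_of_le (Finset.one_lt_card.2 ⟨f a, ?_, f b, hfM b, hfab⟩) (hML b)
        rw [← hτ]
        exact hfM a
      obtain ⟨y, hy, hyx⟩ := Finset.exists_mem_ne hcard x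
      exact ⟨y, hy, fun _ => hyx.symm⟩
    · obtain ⟨y, hy⟩ := hne b
      exact ⟨y, hy, fun h => absurd h hτ⟩
  refine ⟨fun v => if v = a then x else y, fun v => ?_, isDistinguishing_of_injective _ ?_⟩
  · rcases hV v with rfl | rfl
    · simpa using hx
    · simpa [hab.symm] using hy
  · intro u v huv
    simp only [Prod.mk.injEq] at huv
    rcases hV u with rfl | rfl <;> rcases hV v with rfl | rfl
    · rfl
    · simp only [if_true, if_neg hab.symm] at huv
      exact absurd huv.2 (hxy huv.1)
    · simp only [if_true, if_neg hab.symm] at huv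
      exact absurd huv.2.symm (hxy huv.1.symm)
    · rfl

/-- If a tree with typed vertices has a distinguishing coloring in which the vertices of type `θ`
use the list `M θ`, it has one from any lists that are at least as long. -/
theorem IsTree.exists_isDistinguishing_of_card_le {V : Type*} [Finite V] {T : SimpleGraph V}
    (hT : T.IsTree) {Θ C : Type} [Finite Θ] {τ : V → Θ} {M : Θ → Finset C} {L : V → Finset C}
    (hML : ∀ v, (M (τ v)).card ≤ (L v).card) {f : V → C} (hfM : ∀ v, f v ∈ M (τ v))
    (hf : T.IsDistinguishing fun v => (τ v, f v)) :
    ∃ g : V → C, (∀ v, g v ∈ L v) ∧ T.IsDistinguishing fun v => (τ v, g v) := by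
  induction hn : Nat.card V using Nat.strong_induction_on generalizing V Θ C with
  | _ n ih =>
  subst hn
  have := Fintype.ofFinite V
  have := Fintype.ofFinite Θ
  have : Nonempty C := hT.connected.nonempty.map f
  -- A lone vertex is its own core, so pruning would not shrink it.
  rcases subsingleton_or_nontrivial V with hV | hV
  · have hne : ∀ v, (L v).Nonempty := fun v =>
      Finset.card_pos.1 ((Finset.card_pos.2 ⟨_, hfM v⟩).trans_le (hML v))
    choose g hg using hne
    exact ⟨g, hg, isDistinguishing_of_injective _ (Function.injective_of_subsingleton _)⟩
  -- Two adjacent pendant vertices are the whole tree and would leave an empty core; otherwise every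
  -- pendant vertex has its neighbor in the core.
  by_cases hedge : ∃ a b, (∀ x, T.Adj a x ↔ x = b) ∧ ∀ x, T.Adj b x ↔ x = a
  · obtain ⟨a, b, ha, hb⟩ := hedge
    exact exists_isDistinguishing_of_pair ((ha b).2 rfl).ne
      (hT.connected.eq_or_eq_of_adj_iff ha hb) ha hb hML hfM hf
  have hexists : ∀ v, ∃ w : T.core, (v ∈ T.core → (w : V) = v) ∧
      (v ∉ T.core → ∀ x, T.Adj v x ↔ x = w) := by
    intro v
    by_cases hv : v ∈ T.core
    · exact ⟨⟨v, hv⟩, fun _ => rfl, fun h => absurd hv h⟩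
    · obtain ⟨p, hp⟩ := not_not.1 hv
      refine ⟨⟨p, ?_⟩, fun h => absurd h hv, fun _ => hp⟩
      rintro ⟨q, hq⟩
      obtain rfl := (hq v).1 ((hp p).2 rfl).symm
      exact hedge ⟨v, p, hp, hq⟩
  choose r hrcore hrpend using hexists
  have hr : T.IsPruning r := ⟨fun w => Subtype.ext (hrcore w w.2), hrpend⟩
  have htree : (T.induce T.core).IsTree :=
    ⟨hr.connected_induce_core hT.connected, hT.isAcyclic.induce _⟩
  have hcard : Nat.card T.core < Nat.card V := by
    obtain ⟨v, hv⟩ := hT.exists_isPendant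
    exact Finite.card_subtype_lt (x := v) (not_not.2 hv)
  obtain ⟨g', hg'L, hg'⟩ := ih _ hcard htree (τ := prunedType r τ) (M := prunedTypeList M)
    (L := fun w => prunedList (L w) (pendantCell r τ w) L) (card_prunedTypeList_le hML)
    (prunedColoring_mem_prunedTypeList hfM (hr.injOn_pendantCell hf))
    (hr.isDistinguishing_pruned hf) rfl
  obtain ⟨g, hgL, hinj, rfl⟩ := hr.exists_coloring_of_prunedList hg'L
  exact ⟨g, hgL, hr.isDistinguishing_of_pruned hinj hg'⟩

theorem IsTree.hasDistinguishingColoring_iff [Finite V] (hT : T.IsTree) (k : ℕ) :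
    T.HasDistinguishingColoring k ↔
      ∀ L : V → Finset ℕ, (∀ v, (L v).card = k) → T.IsListDistinguishable L := by
  constructor
  · rintro ⟨f, hf⟩ L hL
    -- A single type imposes no constraint, and its common list is the k colors of f.
    obtain ⟨g, hgL, hg⟩ := hT.exists_isDistinguishing_of_card_le (τ := fun _ => ())
      (M := fun _ => Finset.range k) (L := L) (f := fun v => f v) (by simp [hL]) (by simp)
      (fun σ hσ => hf σ fun v => Fin.ext (congrArg Prod.snd (hσ v)))
    exact ⟨g, hgL, fun σ hσ => hg σ fun v => Prod.ext rfl (hσ v)⟩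
  · intro h
    obtain ⟨f, hfL, hf⟩ := h (fun _ => Finset.range k) (by simp)
    exact ⟨fun v => ⟨f v, Finset.mem_range.1 (hfL v)⟩,
      fun σ hσ => hf σ fun v => congrArg Fin.val (hσ v)⟩

end Trees

end SimpleGraph

theorem theorem1 {V : Type*} [Finite V] (T : SimpleGraph V) (hT : T.IsTree) :
    T.distinguishingNumber = T.listDistinguishingNumber := by
  simp only [SimpleGraph.distinguishingNumber, SimpleGraph.listDistinguishingNumber,
    hT.hasDistinguishingColoring_iff]
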